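/- Let $r\ge 1$ be an integer. An $r$-permutation of $[n]=\{1,\dots,n\}$ is an arrangement $a_1a_2\cdots a_{rn}$ of the multiset $\{1^r,2^r,\dots,n^r\}$ such that $a_j\le a_i$ whenever $i<j<k$ and $a_i=a_k$. For a word $w$ of positive integers define $S(w)$ recursively by $S(\emptyset)=\emptyset$ and, if $m$ is the largest letter of $w$ and $w=\alpha_1 m\alpha_2 m\cdots m\alpha_s$ with no $m$ in any $\alpha_i$, by $S(w)=S(\alpha_1)S(\alpha_2)\cdots S(\alpha_s)\,m$. A $k$-tuple $r$-permutation of $[n]$ is a $k$-tuple $(\alpha_1,\dots,\alpha_k)$ of (possibly empty) words such that $\alpha_1\alpha_2\cdots\alpha_k$ is an $r$-permutation of $[n]$ and each letter appears in only one of the $\alpha_i$; it is two-stack-sortable if $S(S(\alpha_1)S(\alpha_2)\cdots S(\alpha_k))=12\cdots n$. For $k\ge 0$ let $p_n^{(k)}$ be the number of two-stack-sortable $k$-tuple $r$-permutations of $[n]$, and let $p_k=\sum_{n\ge 0}p_n^{(k)}x^n\in\mathbb{Q}[[x]]$. There is a unique formal power series $y\in\mathbb{Q}[[x]]$ with $$x=\frac{y}{(1+y)^{2r+1}},$$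 and for every $k\ge 0$ the series $p_k$ is a polynomial in $y$ of degree at most $2k$; that is, there is a polynomial $Q\in\mathbb{Q}[Y]$ with $\deg Q\le 2k$ and $p_k=Q(y)$. -/

import Mathlib

namespace StackSort

/-- An `r`-permutation of `[n]`: a word in which each of `1, …, n` occurs exactly `r` times (and
no other letter occurs) and which has no subsequence `a b a` with `b > a`, that is, whenever
`i < j < k` and `w i = w k`, then `w j ≤ w i`. -/
def IsRPerm (r n : ℕ) (w : List ℕ) : Prop :=
  (∀ a : ℕ, w.count a = if 1 ≤ a ∧ a ≤ n then r else 0) ∧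
    ∀ a b : ℕ, List.Sublist [a, b, a] w → b ≤ a

/-- The largest letter of a word (`0` for the empty word). -/
def maxLetter (w : List ℕ) : ℕ := w.foldr max 0

theorem maxLetter_mem : ∀ {w : List ℕ}, w ≠ [] → maxLetter w ∈ w
  | [], h => absurd rfl h
  | [a], _ => by simp [maxLetter]
  | a :: b :: l, _ => by
    have ih := maxLetter_mem (w := b :: l) (by simp)
    have e : maxLetter (a :: b :: l) = max a (maxLetter (b :: l)) := rfl
    rw [e]
    rcases max_choice a (maxLetter (b :: l)) with h | h <;> rw [h]
    · exact List.mem_cons_self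
    · exact List.mem_cons_of_mem _ ih

theorem length_le_of_mem_splitOn {m : ℕ} {w : List ℕ} :
    ∀ v ∈ w.splitOn m, v.length ≤ w.length := by
  induction w with
  | nil => simp
  | cons a l ih =>
    intro v hv
    rw [List.splitOn, List.splitOnP_cons_eq_if_modifyHead] at hv
    change ∀ v ∈ List.splitOnP (fun x => x == m) l, _ at ih
    by_cases h : a = m
    · simp only [h, beq_self_eq_true, if_true, List.mem_cons] at hv
      rcases hv with rfl | hv
      · simp
      · exact (ih v hv).trans (by simp)
    · simp only [beq_iff_eq, h, if_false] at hv
      cases hs : List.splitOnP (fun x => x == m) l with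
      | nil => simp [hs] at hv
      | cons p ps =>
        rw [hs] at hv ih
        simp only [List.modifyHead_cons, List.mem_cons] at hv
        rcases hv with rfl | hv
        · simpa using ih p (by simp)
        · exact (ih v (by simp [hv])).trans (by simp)

theorem length_lt_of_mem_splitOn {m : ℕ} {w : List ℕ} (hm : m ∈ w) :
    ∀ v ∈ w.splitOn m, v.length < w.length := by
  induction w with
  | nil => simp at hm
  | cons a l ih =>
    intro v hv
    have hle := length_le_of_mem_splitOn (m := m) (w := l)
    rw [List.splitOn, List.splitOnP_cons_eq_if_modifyHead] at hv
    change m ∈ l → ∀ v ∈ List.splitOnP (fun x => x == m) l, _ at ih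
    change ∀ v ∈ List.splitOnP (fun x => x == m) l, _ at hle
    by_cases h : a = m
    · simp only [h, beq_self_eq_true, if_true, List.mem_cons] at hv
      rcases hv with rfl | hv
      · simp
      · exact lt_of_le_of_lt (hle v hv) (by simp)
    · have hl : m ∈ l := by
        rcases List.mem_cons.1 hm with h' | h'
        · exact absurd h'.symm h
        · exact h'
      simp only [beq_iff_eq, h, if_false] at hv
      cases hs : List.splitOnP (fun x => x == m) l with
      | nil => simp [hs] at hv
      | cons p ps =>
        rw [hs] at hv ih
        simp only [List.modifyHead_cons, List.mem_cons] at hv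
        rcases hv with rfl | hv
        · simpa using ih hl p (by simp)
        · exact (ih hl v (by simp [hv])).trans (by simp)

/-- The stack-sorting operation: `S ∅ = ∅`, and for a nonempty word with largest letter `m`,
written as `α₁ m α₂ m ⋯ m αₛ` with no `m` in any `αᵢ`, `S w = S α₁ S α₂ ⋯ S αₛ m`. -/
def stackSort (w : List ℕ) : List ℕ :=
  if h : w = [] then []
  else
    ((w.splitOn (maxLetter w)).attach.map fun v => stackSort v.1).flatten ++ [maxLetter w]
termination_by w.length
decreasing_by exact length_lt_of_mem_splitOn (maxLetter_mem h) _ v.2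

theorem stackSort_nil : stackSort [] = [] := by
  rw [stackSort]; simp

theorem stackSort_of_ne_nil {w : List ℕ} (h : w ≠ []) :
    stackSort w = ((w.splitOn (maxLetter w)).map stackSort).flatten ++ [maxLetter w] := by
  rw [stackSort, dif_neg h, List.attach_map_val]

/-- A `k`-tuple `r`-permutation of `[n]` (components may be empty): the concatenation of the
components is an `r`-permutation of `[n]`, and any letter appears in only one component. -/
def IsTupleRPerm (r n k : ℕ) (α : Fin k → List ℕ) : Prop :=
  IsRPerm r n (List.ofFn α).flatten ∧ ∀ (i j : Fin k) (a : ℕ), a ∈ α i → a ∈ α j → i = j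

/-- `(α₁, …, αₖ)` is a two-stack-sortable `k`-tuple `r`-permutation of `[n]` if
`S (S α₁ ⋯ S αₖ)` is the identity permutation `1 2 ⋯ n`. -/
def IsTwoStackSortable (r n k : ℕ) (α : Fin k → List ℕ) : Prop :=
  IsTupleRPerm r n k α ∧
    stackSort (List.ofFn fun i => stackSort (α i)).flatten = List.range' 1 n

/-- For given `r, n, k` there are only finitely many such tuples, so that counting them with
`Set.ncard` is meaningful. -/
theorem finite_setOf_isTwoStackSortable (r n k : ℕ) :
    {α : Fin k → List ℕ | IsTwoStackSortable r n k α}.Finite := by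
  let u : List ℕ := (List.range' 1 n).flatMap (List.replicate r)
  have hu : ∀ a, u.count a = if 1 ≤ a ∧ a ≤ n then r else 0 := by
    intro a
    induction n with
    | zero => simp [u]; omega
    | succ n ih =>
      simp only [u] at ih ⊢
      rw [List.range'_1_concat, List.flatMap_append, List.count_append, ih]
      simp only [List.flatMap_cons, List.flatMap_nil, List.append_nil, List.count_replicate,
        beq_iff_eq]
      split_ifs <;> omega
  have hfin : {v : List ℕ | ∃ w, w.Perm u ∧ List.Sublist v w}.Finite := by
    refine (u.permutations.flatMap List.sublists).toFinset.finite_toSet.subset ?_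
    rintro v ⟨w, hw, hv⟩
    simp only [List.coe_toFinset, List.mem_flatMap, List.mem_permutations, List.mem_sublists,
      Set.mem_ofPred_eq]
    exact ⟨w, hw, hv⟩
  refine (Set.Finite.pi' fun _ : Fin k => hfin).subset ?_
  rintro α ⟨⟨⟨hc, -⟩, -⟩, -⟩ i
  refine ⟨_, List.perm_iff_count.2 fun a => (hc a).trans (hu a).symm, ?_⟩
  exact List.sublist_flatten_of_mem (List.mem_ofFn.2 ⟨i, rfl⟩)

/-- `p_n^{(k)}`: the number of two-stack-sortable `k`-tuple `r`-permutations of `[n]`, where any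
component is allowed to be empty. -/
noncomputable def pCoeff (r k n : ℕ) : ℕ :=
  {α : Fin k → List ℕ | IsTwoStackSortable r n k α}.ncard

/-- `p_k = ∑ₙ p_n^{(k)} xⁿ` as a formal power series in `x`. -/
noncomputable def pSeries (r k : ℕ) : PowerSeries ℚ :=
  PowerSeries.mk fun n => (pCoeff r k n : ℚ)

/-- The equation `x = y / (1 + y)^(2r+1)` for a formal power series `y` in `x`.  It forces the
constant coefficient of `1 + y` to be nonzero: otherwise the right-hand side is `0`. -/
def IsY (r : ℕ) (y : PowerSeries ℚ) : Prop :=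
  (PowerSeries.X : PowerSeries ℚ) = y * ((1 + y) ^ (2 * r + 1))⁻¹

end StackSort

/-! Deleting the r copies of the largest letter n+1 turns the component that contains it into r+1
words, pairwise disjoint because a letter shared by two of them would enclose n+1. If i components
come before, the first pass puts n+1 right after the sorted images of the first i+1+r words, so the
second pass treats these words and the other k-1-i independently. The outcome is the identity
exactly when the two groups yield 1,…,j and j+1,…,n for some j. Hence p_k = 1 + x ∑_{i<k} p_{i+1+r}
p_{k-1-i} (`pSeries_eq`), a system with a unique solution by successive approximation in x
(`eq_of_quadratic_recurrence`).

It remains to solve the system with x = y/(1+y)^(2r+1) by polynomials Q_k of degree at most 2k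
(`exists_polynomial_recurrence`). Put P = ∑ Q_k t^k and W = (1+y)^(2r+1) - y ∑_{j≥1} Q_{r+j} t^j.
The system says W P = (1+y)^(2r+1)/(1-t), and t^r W + y P has degree at most r in t. Both hold for P
= b^r C and t^r W = (1+y)^(2r+1) a^r D, where ab = t, CD = 1/(1-t), and b and (1+y)²a are the roots
of z² - (1+(1+2y)t)z + (1+y)²t: the combination t^r W + y P then obeys a linear recurrence in r with
coefficients linear in t. All of a, b, C, D are polynomials in y, t and one series v = tg, and the
quadratic equation for g gives the degree bound. -/

namespace StackSort

/-! ### Fixed points in the X-adic topology and the series y -/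

/-- A map of power series that raises the order of agreement by one has a fixed point, which is
the limit of its iterates. -/
theorem exists_fixedPoint {R : Type*} [CommRing R] (Φ : PowerSeries R → PowerSeries R)
    (hΦ : ∀ n f g, (PowerSeries.X : PowerSeries R) ^ n ∣ f - g →
      (PowerSeries.X : PowerSeries R) ^ (n + 1) ∣ Φ f - Φ g) :
    ∃ f, Φ f = f ∧ ∀ n, (PowerSeries.X : PowerSeries R) ^ n ∣ f - Φ^[n] 0 := by
  have hstep : ∀ n, (PowerSeries.X : PowerSeries R) ^ n ∣ Φ^[n + 1] 0 - Φ^[n] 0 := by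
    intro n
    induction n with
    | zero => simp
    | succ n ih =>
      have := hΦ _ _ _ ih
      rwa [← Function.iterate_succ_apply' Φ, ← Function.iterate_succ_apply' Φ] at this
  have hle : ∀ n k, (PowerSeries.X : PowerSeries R) ^ n ∣ Φ^[n + k] 0 - Φ^[n] 0 := by
    intro n k
    induction k with
    | zero => simp
    | succ k ih =>
      have h := (pow_dvd_pow PowerSeries.X (Nat.le_add_right n k)).trans (hstep (n + k))
      have := dvd_add h ih
      rwa [sub_add_sub_cancel] at this
  let f : PowerSeries R := PowerSeries.mk fun n => PowerSeries.coeff n (Φ^[n + 1] 0)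
  have hf : ∀ n, (PowerSeries.X : PowerSeries R) ^ n ∣ f - Φ^[n] 0 := by
    intro n
    rw [PowerSeries.X_pow_dvd_iff]
    intro d hd
    obtain ⟨k, rfl⟩ := Nat.exists_eq_add_of_lt hd
    have := PowerSeries.X_pow_dvd_iff.1 (hle (d + 1) k) d (Nat.lt_succ_self d)
    rw [map_sub, sub_eq_zero] at this
    rw [map_sub, PowerSeries.coeff_mk, ← this, add_right_comm, sub_self]
  refine ⟨f, ?_, hf⟩
  rw [← sub_eq_zero]
  ext n
  have h1 := hΦ n _ _ (hf n)
  rw [← Function.iterate_succ_apply' Φ] at h1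
  have h2 := dvd_sub h1 (hf (n + 1))
  rw [sub_sub_sub_cancel_right] at h2
  simpa using PowerSeries.X_pow_dvd_iff.1 h2 n (Nat.lt_succ_self n)

theorem eq_of_fixedPoint {R : Type*} [CommRing R] {Φ : PowerSeries R → PowerSeries R}
    (hΦ : ∀ n f g, (PowerSeries.X : PowerSeries R) ^ n ∣ f - g →
      (PowerSeries.X : PowerSeries R) ^ (n + 1) ∣ Φ f - Φ g)
    {f g : PowerSeries R} (hf : Φ f = f) (hg : Φ g = g) : f = g := by
  have h : ∀ n, (PowerSeries.X : PowerSeries R) ^ n ∣ f - g := by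
    intro n
    induction n with
    | zero => simp
    | succ n ih => simpa only [hf, hg] using hΦ n f g ih
  rw [← sub_eq_zero]
  ext n
  simpa using PowerSeries.X_pow_dvd_iff.1 (h (n + 1)) n (Nat.lt_succ_self n)

theorem isY_iff {r : ℕ} {y : PowerSeries ℚ} :
    IsY r y ↔ PowerSeries.X * (1 + y) ^ (2 * r + 1) = y := by
  unfold IsY
  constructor
  · intro h
    by_cases h0 : PowerSeries.constantCoeff ((1 + y) ^ (2 * r + 1)) = 0
    · rw [PowerSeries.inv_eq_zero.2 h0, mul_zero] at h
      exact absurd h PowerSeries.X_ne_zero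
    · exact (PowerSeries.eq_mul_inv_iff_mul_eq h0).1 h
  · intro h
    have hy : PowerSeries.constantCoeff y = 0 := by rw [← h]; simp
    refine (PowerSeries.eq_mul_inv_iff_mul_eq ?_).2 h
    simp [hy]

/-- The factor X makes y ↦ X(1+y)^(2r+1) an X-adic contraction. -/
theorem existsUnique_isY (r : ℕ) : ∃! y : PowerSeries ℚ, IsY r y := by
  have hΦ : ∀ n (f g : PowerSeries ℚ), (PowerSeries.X : PowerSeries ℚ) ^ n ∣ f - g →
      (PowerSeries.X : PowerSeries ℚ) ^ (n + 1) ∣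
        PowerSeries.X * (1 + f) ^ (2 * r + 1) - PowerSeries.X * (1 + g) ^ (2 * r + 1) := by
    intro n f g h
    rw [← mul_sub, pow_succ']
    refine mul_dvd_mul_left _ (h.trans ?_)
    simpa using sub_dvd_pow_sub_pow (1 + f) (1 + g) (2 * r + 1)
  obtain ⟨y, hy, -⟩ := exists_fixedPoint _ hΦ
  exact ⟨y, isY_iff.2 hy, fun z hz => eq_of_fixedPoint hΦ (isY_iff.1 hz) hy⟩

/-! ### Polynomials solving the recurrence -/

/-- The power series over `R[Y]` whose `k`-th coefficient has degree at most `2 * k`. -/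
def boundedSubring (R : Type*) [CommRing R] : Subring (PowerSeries (Polynomial R)) where
  carrier := {F | ∀ k, (PowerSeries.coeff k F).natDegree ≤ 2 * k}
  mul_mem' := by
    intro F G hF hG k
    rw [PowerSeries.coeff_mul]
    refine Polynomial.natDegree_sum_le_of_forall_le _ _ fun p hp => ?_
    have := Finset.HasAntidiagonal.mem_antidiagonal.1 hp
    refine Polynomial.natDegree_mul_le.trans ?_
    have h1 := hF p.1
    have h2 := hG p.2
    omega
  one_mem' := by
    intro k
    rw [PowerSeries.coeff_one]
    split_ifs <;> simp
  add_mem' := by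
    intro F G hF hG k
    rw [map_add]
    exact (Polynomial.natDegree_add_le _ _).trans (max_le (hF k) (hG k))
  zero_mem' := by intro k; simp
  neg_mem' := by
    intro F hF k
    simpa using hF k

theorem X_mul_C_mem_boundedSubring {R : Type*} [CommRing R] {c : Polynomial R}
    (hc : c.natDegree ≤ 2) : PowerSeries.X * PowerSeries.C c ∈ boundedSubring R := by
  intro k
  rcases k with _ | _ | k
  · simp
  · simpa using hc
  · rw [PowerSeries.coeff_succ_X_mul, PowerSeries.coeff_C, if_neg (by omega)]
    simp

section Parametrization

open Polynomial

/-- A rational parametrization: the series `v = t g` with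
`t = v (1 - y (1 + y) v) / ((1 + (1 + y) v) (1 - y v))`. -/
theorem exists_parametrization : ∃ g ∈ boundedSubring ℚ,
    g = 1 + PowerSeries.X * g + PowerSeries.C (X * (1 + X) : ℚ[X]) *
      (PowerSeries.X - PowerSeries.X ^ 2) * g ^ 2 := by
  let Φ : PowerSeries ℚ[X] → PowerSeries ℚ[X] := fun g =>
    1 + PowerSeries.X * g + PowerSeries.C (X * (1 + X) : ℚ[X]) *
      (PowerSeries.X - PowerSeries.X ^ 2) * g ^ 2
  have hΦ : ∀ n f g, (PowerSeries.X : PowerSeries ℚ[X]) ^ n ∣ f - g →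
      (PowerSeries.X : PowerSeries ℚ[X]) ^ (n + 1) ∣ Φ f - Φ g := by
    intro n f g h
    have e : Φ f - Φ g = PowerSeries.X * ((f - g) * (1 + PowerSeries.C (X * (1 + X) : ℚ[X]) *
        (1 - PowerSeries.X) * (f + g))) := by
      simp only [Φ]; ring
    rw [e, pow_succ']
    exact mul_dvd_mul_left _ (h.mul_right _)
  have hX : (PowerSeries.X : PowerSeries ℚ[X]) ∈ boundedSubring ℚ := by
    simpa using X_mul_C_mem_boundedSubring (R := ℚ) (c := 1) (by simp)
  have hq : PowerSeries.X * PowerSeries.C (X * (1 + X) : ℚ[X]) ∈ boundedSubring ℚ := by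
    refine X_mul_C_mem_boundedSubring ?_
    compute_degree
  have hmem : ∀ g ∈ boundedSubring ℚ, Φ g ∈ boundedSubring ℚ := by
    intro g hg
    have e : Φ g = 1 + PowerSeries.X * g + PowerSeries.X * PowerSeries.C (X * (1 + X) : ℚ[X]) *
        (1 - PowerSeries.X) * g ^ 2 := by
      simp only [Φ]; ring
    rw [e]
    exact add_mem (add_mem (one_mem _) (mul_mem hX hg))
      (mul_mem (mul_mem hq (sub_mem (one_mem _) hX)) (pow_mem hg 2))
  obtain ⟨g, hg, hlim⟩ := exists_fixedPoint Φ hΦ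
  refine ⟨g, fun k => ?_, hg.symm⟩
  have hit : ∀ n, Φ^[n] 0 ∈ boundedSubring ℚ := by
    intro n
    induction n with
    | zero => exact zero_mem _
    | succ n ih => rw [Function.iterate_succ_apply']; exact hmem _ ih
  -- The k-th coefficient of the limit is already that of iterate k+1, which lies in the subring.
  have := PowerSeries.X_pow_dvd_iff.1 (hlim (k + 1)) k (Nat.lt_succ_self k)
  rw [map_sub, sub_eq_zero] at this
  rw [this]
  exact hit _ k

/-- If `p` satisfies a linear recurrence whose coefficients have degree at most one in `X`, and
`p 0`, `p 1` have degrees at most `0`, `1`, then `p n` has degree at most `n`. -/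
theorem coeff_eq_zero_of_linear_recurrence {R : Type*} [CommRing R] {H : ℕ → PowerSeries R}
    {c d e f : R} (h0 : H 0 = PowerSeries.C e)
    (h1 : ∃ e' , H 1 = PowerSeries.C f + PowerSeries.X * PowerSeries.C e')
    (h : ∀ n, H (n + 2) = (1 + PowerSeries.X * PowerSeries.C c) * H (n + 1) -
      PowerSeries.X * PowerSeries.C d * H n) (n : ℕ) :
    ∀ k, n < k → PowerSeries.coeff k (H n) = 0 := by
  induction n using Nat.twoStepInduction with
  | zero =>
    intro k hk
    rw [h0, PowerSeries.coeff_C, if_neg (by omega)]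
  | one =>
    intro k hk
    obtain ⟨e', h1⟩ := h1
    obtain ⟨k, rfl⟩ := Nat.exists_eq_add_of_lt hk
    rw [h1, map_add, PowerSeries.coeff_succ_X_mul, PowerSeries.coeff_C, PowerSeries.coeff_C,
      if_neg (by omega), if_neg (by omega), add_zero]
  | more n ih1 ih2 =>
    intro k hk
    obtain ⟨k, rfl⟩ := Nat.exists_eq_add_of_lt (Nat.zero_lt_of_lt hk)
    rw [h, add_mul, one_mul, mul_assoc, mul_assoc, map_sub, map_add, PowerSeries.coeff_succ_X_mul,
      PowerSeries.coeff_succ_X_mul, PowerSeries.coeff_C_mul, PowerSeries.coeff_C_mul,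
      ih2 _ (by omega), ih2 _ (by omega), ih1 _ (by omega)]
    simp

/-- There are polynomials `Q k` of degree at most `2 * k` satisfying the recurrence of the series
`p_k`, written in terms of `y`. -/
theorem exists_polynomial_recurrence (r : ℕ) : ∃ Q : ℕ → ℚ[X], (∀ k, (Q k).natDegree ≤ 2 * k) ∧
    ∀ k, (1 + X) ^ (2 * r + 1) * Q k = (1 + X) ^ (2 * r + 1) +
      X * ∑ i ∈ Finset.range k, Q (r + (i + 1)) * Q (k - (i + 1)) := by
  obtain ⟨g, hgmem, hg⟩ := exists_parametrization
  set t : PowerSeries ℚ[X] := PowerSeries.X with ht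
  set y : PowerSeries ℚ[X] := PowerSeries.C X with hy
  have hq : PowerSeries.C (X * (1 + X) : ℚ[X]) = y * (1 + y) := by simp [hy]
  rw [hq] at hg
  have htm : t ∈ boundedSubring ℚ := by
    simpa using X_mul_C_mem_boundedSubring (R := ℚ) (c := 1) (by simp)
  have htym : t * y ∈ boundedSubring ℚ := X_mul_C_mem_boundedSubring (by simp)
  have htqm : t * (y * (1 + y)) ∈ boundedSubring ℚ := by
    rw [← hq]
    refine X_mul_C_mem_boundedSubring ?_
    compute_degree
  obtain ⟨v, hv⟩ : ∃ v, v = t * g := ⟨_, rfl⟩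
  have hveq : v = t + t * v + y * (1 + y) * (1 - t) * v ^ 2 := by
    rw [hv]; linear_combination t * hg
  obtain ⟨Cc, hC⟩ : ∃ Cc, Cc = 1 + (1 + y) * v := ⟨_, rfl⟩
  obtain ⟨D, hD⟩ : ∃ D, D = 1 - y * v := ⟨_, rfl⟩
  -- The quadratic equation for v is precisely this factorization of 1/(1-t).
  have hCD : Cc * D * (1 - t) = 1 := by
    rw [hC, hD]; linear_combination hveq
  obtain ⟨a, ha⟩ : ∃ a, a = v * D * (1 - t) := ⟨_, rfl⟩
  obtain ⟨b, hb⟩ : ∃ b, b = (1 - y * (1 + y) * v) * Cc * (1 - t) := ⟨_, rfl⟩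
  have hab : a * b = t := by
    rw [ha, hb]
    linear_combination v * (1 - y * (1 + y) * v) * (1 - t) * hCD + hveq
  have hsum : b + (1 + y) ^ 2 * a = 1 + (1 + 2 * y) * t := by
    rw [hC, hD] at hCD
    rw [hb, ha, hC, hD]
    linear_combination 2 * (1 + y) * hCD
  -- The constant series y violates the bound at t^0, so each power of y is kept together with the
  -- factor t of v = tg.
  have hvm : v ∈ boundedSubring ℚ := by rw [hv]; exact mul_mem htm hgmem
  have hyvm : y * v ∈ boundedSubring ℚ := by
    rw [hv, ← mul_assoc, mul_comm y]; exact mul_mem htym hgmem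
  have hqvm : y * (1 + y) * v ∈ boundedSubring ℚ := by
    rw [hv, ← mul_assoc, mul_comm _ t]; exact mul_mem htqm hgmem
  have hCm : Cc ∈ boundedSubring ℚ := by
    rw [hC, add_mul, one_mul]; exact add_mem (one_mem _) (add_mem hvm hyvm)
  have hbm : b ∈ boundedSubring ℚ := by
    rw [hb]
    exact mul_mem (mul_mem (sub_mem (one_mem _) hqvm) hCm) (sub_mem (one_mem _) htm)
  obtain ⟨P, hP⟩ : ∃ P, P = b ^ r * Cc := ⟨_, rfl⟩
  have hPm : P ∈ boundedSubring ℚ := by rw [hP]; exact mul_mem (pow_mem hbm r) hCm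
  -- A combination of n-th powers of b and (1+y)²a; their sum 1+(1+2y)t and product (1+y)²t are the
  -- coefficients of its recurrence.
  obtain ⟨H, hH⟩ : ∃ H : ℕ → PowerSeries ℚ[X],
      H = fun n => y * b ^ n * Cc + (1 + y) * ((1 + y) ^ 2 * a) ^ n * D := ⟨_, rfl⟩
  have hH0 : H 0 = PowerSeries.C (1 + 2 * X) := by
    have : PowerSeries.C (1 + 2 * X : ℚ[X]) = 1 + 2 * y := by
      rw [hy, map_add, map_mul, map_one, map_ofNat]
    rw [this, hH, hC, hD]; ring
  have hH1 : H 1 = PowerSeries.C X + t * PowerSeries.C ((1 + 2 * X) ^ 2) := by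
    have : PowerSeries.C ((1 + 2 * X) ^ 2 : ℚ[X]) = (1 + 2 * y) ^ 2 := by
      rw [hy, map_pow, map_add, map_mul, map_one, map_ofNat]
    rw [hC, hD] at hCD
    simp only [this, hH, hb, ha, hC, hD]
    linear_combination (y + (1 + 2 * y) ^ 2) * hCD
  have hHrec : ∀ n, H (n + 2) = (1 + t * PowerSeries.C (1 + 2 * X)) * H (n + 1) -
      t * PowerSeries.C ((1 + X) ^ 2) * H n := by
    intro n
    have e1 : PowerSeries.C (1 + 2 * X : ℚ[X]) = 1 + 2 * y := by
      rw [hy, map_add, map_mul, map_one, map_ofNat]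
    have e2 : PowerSeries.C ((1 + X) ^ 2 : ℚ[X]) = (1 + y) ^ 2 := by
      rw [hy, map_pow, map_add, map_one]
    obtain ⟨c, hc⟩ : ∃ c, c = (1 + y) ^ 2 * a := ⟨_, rfl⟩
    have e3 : 1 + t * (1 + 2 * y) = b + c := by rw [hc, hsum]; ring
    have e4 : t * (1 + y) ^ 2 = b * c := by rw [hc, ← hab]; ring
    rw [e1, e2, e3, e4, hH]
    simp only [← hc]
    ring
  have hHdeg := coeff_eq_zero_of_linear_recurrence hH0 ⟨_, hH1⟩ hHrec r
  -- Here g D (1-t) is a/t, so this is (1+y)^(2r+1) (a/t)^r D.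
  obtain ⟨W, hW⟩ : ∃ W, W = (1 + y) ^ (2 * r + 1) * (g * D * (1 - t)) ^ r * D := ⟨_, rfl⟩
  have hWH : t ^ r * W = H r - y * P := by
    obtain ⟨c, hc⟩ : ∃ c, c = g * D * (1 - t) := ⟨_, rfl⟩
    have hac : a = t * c := by rw [ha, hc, hv]; ring
    simp only [hW, hH, hP, ← hc, hac, mul_pow, ← pow_mul]
    ring
  have hWP : (1 + y) ^ (2 * r + 1) = W * P * (1 - t) := by
    have e : (g * D * (1 - t)) ^ r * b ^ r = 1 := by
      have : t * (g * D * (1 - t) * b) = t * 1 := by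
        rw [mul_one]; conv_rhs => rw [← hab, ha, hv]
        ring
      rw [← mul_pow, mul_left_cancel₀ PowerSeries.X_ne_zero this, one_pow]
    rw [hW, hP]
    linear_combination (-(1 + y) ^ (2 * r + 1) * (1 - t) * Cc * D) * e -
      (1 + y) ^ (2 * r + 1) * hCD
  -- `H r` has degree at most r in t, so beyond t^r the series t^r W and -yP agree.
  have hWcoeff : ∀ i, PowerSeries.coeff (i + 1) W = - (X * PowerSeries.coeff (r + (i + 1)) P) := by
    intro i
    have := congrArg (PowerSeries.coeff (i + 1 + r)) hWH
    rw [ht, PowerSeries.coeff_X_pow_mul, map_sub, hHdeg _ (by omega), hy,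
      PowerSeries.coeff_C_mul] at this
    rw [this, add_comm r]; ring
  have hg0 : PowerSeries.constantCoeff g = 1 := by
    rw [hg]; simp [ht]
  have hW0 : PowerSeries.coeff 0 W = (1 + X) ^ (2 * r + 1) := by
    rw [PowerSeries.coeff_zero_eq_constantCoeff_apply, hW, hD, hv]
    simp [ht, hy, hg0]
  refine ⟨fun k => PowerSeries.coeff k P, hPm, fun k => ?_⟩
  -- `PowerSeries.mk 1` is the geometric series 1/(1-t); comparing coefficients of t^k gives the
  -- recurrence, the constant term of W supplying the left-hand side.
  have hWP' : (1 + y) ^ (2 * r + 1) * PowerSeries.mk 1 = W * P := by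
    rw [hWP, mul_assoc, mul_comm (1 - t), PowerSeries.mk_one_mul_one_sub_eq_one, mul_one]
  have e : (1 + y) ^ (2 * r + 1) = PowerSeries.C ((1 + X) ^ (2 * r + 1) : ℚ[X]) := by simp [hy]
  have := congrArg (PowerSeries.coeff k) hWP'
  rw [e, PowerSeries.coeff_C_mul, PowerSeries.coeff_mk, PowerSeries.coeff_mul,
    Finset.Nat.sum_antidiagonal_eq_sum_range_succ_mk, Finset.sum_range_succ'] at this
  simp only [hWcoeff, hW0, Pi.one_apply, mul_one, Nat.sub_zero] at this
  beta_reduce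
  nth_rewrite 2 [this]
  rw [Finset.mul_sum, add_right_comm, ← Finset.sum_add_distrib, Finset.sum_eq_zero, zero_add]
  intro i _
  ring

end Parametrization

/-! ### Stirling words and splitting at the largest letter -/

section Words

/-- No letter is enclosed by two copies of a smaller letter. -/
def IsStirling (w : List ℕ) : Prop :=
  ∀ a b : ℕ, List.Sublist [a, b, a] w → b ≤ a

/-- A list of words with pairwise disjoint letter sets, each satisfying the Stirling condition and
containing each of its letters exactly `r` times. -/
def IsStirlingList (r : ℕ) (L : List (List ℕ)) : Prop :=
  L.Pairwise List.Disjoint ∧ ∀ w ∈ L, IsStirling w ∧ ∀ c ∈ w, w.count c = r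

theorem isStirlingList_append {r : ℕ} {L₁ L₂ : List (List ℕ)} :
    IsStirlingList r (L₁ ++ L₂) ↔ IsStirlingList r L₁ ∧ IsStirlingList r L₂ ∧
      ∀ u ∈ L₁, ∀ v ∈ L₂, List.Disjoint u v := by
  simp only [IsStirlingList, List.pairwise_append, List.mem_append, or_imp, forall_and]
  tauto

theorem mem_intercalate_iff {m c : ℕ} {B : List (List ℕ)} :
    c ∈ [m].intercalate B ↔ c ∈ B.flatten ∨ c = m ∧ 2 ≤ B.length := by
  match B with
  | [] => simp
  | [b] => simp
  | b :: b' :: B =>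
    have ih := mem_intercalate_iff (m := m) (c := c) (B := b' :: B)
    rw [List.intercalate_cons_cons, List.append_assoc, List.mem_append, List.mem_append, ih,
      show (b :: b' :: B).flatten = b ++ (b' :: B).flatten from rfl, List.mem_append]
    simp only [List.mem_singleton, List.length_cons]
    have : 2 ≤ B.length + 1 + 1 := by omega
    tauto

theorem count_intercalate {m c : ℕ} {B : List (List ℕ)} :
    ([m].intercalate B).count c = B.flatten.count c + if c = m then B.length - 1 else 0 := by
  match B with
  | [] => simp
  | [b] => simp
  | b :: b' :: B =>
    have ih := count_intercalate (m := m) (c := c) (B := b' :: B)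
    rw [List.intercalate_cons_cons, List.append_assoc, List.count_append, List.count_append, ih,
      show (b :: b' :: B).flatten = b ++ (b' :: B).flatten from rfl, List.count_append,
      List.count_singleton]
    simp only [List.length_cons, beq_iff_eq, eq_comm (a := m)]
    split_ifs <;> omega

theorem exists_eq_intercalate (m : ℕ) (w : List ℕ) :
    ∃ B : List (List ℕ), w = [m].intercalate B ∧ B ≠ [] ∧ ∀ b ∈ B, m ∉ b := by
  induction w with
  | nil => exact ⟨[[]], by simp, by simp, by simp⟩
  | cons a w ih =>
    obtain ⟨B, rfl, hB, hm⟩ := ih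
    by_cases h : a = m
    · subst h
      obtain ⟨b, B, rfl⟩ := List.exists_cons_of_ne_nil hB
      exact ⟨[] :: b :: B, by simp, by simp, by simpa using hm⟩
    · obtain ⟨b, B, rfl⟩ := List.exists_cons_of_ne_nil hB
      refine ⟨(a :: b) :: B, ?_, by simp, ?_⟩
      · cases B <;> simp
      · simp only [List.mem_cons, forall_eq_or_imp, not_or] at hm ⊢
        exact ⟨⟨Ne.symm h, hm.1⟩, hm.2⟩

theorem count_flatten_of_pairwise_disjoint {L : List (List ℕ)} (hL : L.Pairwise List.Disjoint)
    {w : List ℕ} (hw : w ∈ L) {c : ℕ} (hc : c ∈ w) : L.flatten.count c = w.count c := by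
  obtain ⟨L₁, L₂, rfl⟩ := List.append_of_mem hw
  rw [List.pairwise_append, List.pairwise_cons] at hL
  have h1 : c ∉ L₁.flatten := by
    intro h
    obtain ⟨v, hv, hcv⟩ := List.mem_flatten.1 h
    exact hL.2.2 v hv w (by simp) hcv hc
  have h2 : c ∉ L₂.flatten := by
    intro h
    obtain ⟨v, hv, hcv⟩ := List.mem_flatten.1 h
    exact hL.2.1.1 v hv hc hcv
  rw [List.flatten_append, List.flatten_cons, List.count_append, List.count_append,
    List.count_eq_zero.2 h1, List.count_eq_zero.2 h2, zero_add, add_zero]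

theorem IsStirling.sublist {u v : List ℕ} (hv : IsStirling v) (h : List.Sublist u v) :
    IsStirling u := fun a b hab => hv a b (hab.trans h)

/-- A subsequence `a b a` of a concatenation either lies in one of the two parts, or its letter `a`
occurs in both. -/
theorem sublist_append_cases {a b : ℕ} {u v : List ℕ} (h : List.Sublist [a, b, a] (u ++ v)) :
    List.Sublist [a, b, a] u ∨ List.Sublist [a, b, a] v ∨ a ∈ u ∧ a ∈ v := by
  obtain ⟨l₁, l₂, he, h1, h2⟩ := List.sublist_append_iff.1 h
  match l₁ with
  | [] =>
    rw [List.nil_append] at he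
    exact Or.inr (Or.inl (he ▸ h2))
  | [x] =>
    simp only [List.cons_append, List.nil_append, List.cons.injEq] at he
    obtain ⟨rfl, rfl⟩ := he
    exact Or.inr (Or.inr ⟨h1.subset (by simp), h2.subset (by simp)⟩)
  | [x, x'] =>
    simp only [List.cons_append, List.nil_append, List.cons.injEq] at he
    obtain ⟨rfl, rfl, rfl⟩ := he
    exact Or.inr (Or.inr ⟨h1.subset (by simp), h2.subset (by simp)⟩)
  | x :: x' :: x'' :: l =>
    simp only [List.cons_append, List.cons.injEq] at he
    obtain ⟨rfl, rfl, rfl, he⟩ := he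
    obtain rfl : l = [] := by
      cases l with
      | nil => rfl
      | cons _ _ => simp at he
    exact Or.inl h1

/-- A pattern a b a not inside a single word would place a in two of the disjoint words. -/
theorem isStirling_flatten_iff {L : List (List ℕ)} (hL : L.Pairwise List.Disjoint) :
    IsStirling L.flatten ↔ ∀ w ∈ L, IsStirling w := by
  refine ⟨fun h w hw => h.sublist (List.sublist_flatten_of_mem hw), fun h => ?_⟩
  induction L with
  | nil => intro a b hab; simp at hab
  | cons w L ih =>
    rw [List.pairwise_cons] at hL
    intro a b hab
    rw [List.flatten_cons] at hab
    rcases sublist_append_cases hab with hab | hab | ⟨h1, h2⟩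
    · exact h w (by simp) a b hab
    · exact ih hL.2 (fun v hv => h v (by simp [hv])) a b hab
    · obtain ⟨v, hv, hav⟩ := List.mem_flatten.1 h2
      exact absurd hav (hL.1 v hv h1)

/-- A letter c < m in two different blocks would enclose a copy of m; conversely, with disjoint
blocks a pattern a b a has a = m or stays in one block. -/
theorem isStirling_intercalate_iff {m : ℕ} {B : List (List ℕ)} (hB : ∀ b ∈ B, ∀ c ∈ b, c < m) :
    IsStirling ([m].intercalate B) ↔ B.Pairwise List.Disjoint ∧ ∀ b ∈ B, IsStirling b := by
  match B with
  | [] => simp [IsStirling]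
  | [b] => simp
  | b :: b' :: B =>
    have hB' : ∀ v ∈ b' :: B, ∀ c ∈ v, c < m := fun v hv => hB v (List.mem_cons_of_mem _ hv)
    have hb : ∀ c ∈ b, c < m := hB b (by simp)
    have ih := isStirling_intercalate_iff hB'
    rw [List.pairwise_cons, List.forall_mem_cons (p := IsStirling)]
    rw [List.intercalate_cons_cons, List.append_assoc, List.singleton_append]
    set w := [m].intercalate (b' :: B) with hw
    have hmem : ∀ c ∈ w, c ∈ (b' :: B).flatten ∨ c = m := fun c hc =>
      (mem_intercalate_iff.1 hc).imp_right And.left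
    constructor
    · intro h
      obtain ⟨h1, h2⟩ := ih.1 (h.sublist ((List.sublist_cons_self _ _).trans
        (List.sublist_append_right _ _)))
      refine ⟨⟨fun v hv c hcb hcv => ?_, h1⟩, h.sublist (List.sublist_append_left _ _), h2⟩
      have hcw : c ∈ w := mem_intercalate_iff.2 (Or.inl (List.mem_flatten.2 ⟨v, hv, hcv⟩))
      have := h c m (List.Sublist.append (List.singleton_sublist.2 hcb)
        (List.Sublist.cons_cons m (List.singleton_sublist.2 hcw)))
      exact absurd (hb c hcb) (by omega)
    · rintro ⟨⟨h1, h2⟩, h3, h4⟩ c d hcd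
      have hw' := ih.2 ⟨h2, h4⟩
      have hle : ∀ x ∈ m :: w, x ≤ m := by
        intro x hx
        rcases List.mem_cons.1 hx with rfl | hx
        · exact le_rfl
        rcases hmem x hx with hx | rfl
        · obtain ⟨v, hv, hxv⟩ := List.mem_flatten.1 hx
          exact (hB' v hv x hxv).le
        · exact le_rfl
      rcases sublist_append_cases hcd with hcd | hcd | ⟨hc1, hc2⟩
      · exact h3 c d hcd
      · by_cases hcm : c = m
        · rw [hcm]; exact hle d (hcd.subset (by simp))
        · refine hw' c d ?_
          cases hcd with
          | cons _ h => exact h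
          | cons_cons _ h => exact absurd rfl hcm
      · have hlt := hb c hc1
        rcases List.mem_cons.1 hc2 with rfl | hc2
        · exact absurd hlt (lt_irrefl _)
        rcases hmem c hc2 with hc2 | rfl
        · obtain ⟨v, hv, hcv⟩ := List.mem_flatten.1 hc2
          exact absurd hcv (h1 v hv hc1)
        · exact absurd hlt (lt_irrefl _)

theorem isStirlingList_singleton_intercalate_iff {r m : ℕ} {B : List (List ℕ)}
    (hB : ∀ b ∈ B, ∀ c ∈ b, c < m) (hr : B.length = r + 1) :
    IsStirlingList r [[m].intercalate B] ↔ IsStirlingList r B := by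
  simp only [IsStirlingList, List.pairwise_singleton, List.mem_singleton, forall_eq, true_and,
    isStirling_intercalate_iff hB, forall_and, and_assoc]
  refine and_congr_right fun hd => and_congr_right fun _ => ?_
  constructor
  · intro h b hb c hc
    have := h c (mem_intercalate_iff.2 (Or.inl (List.mem_flatten.2 ⟨b, hb, hc⟩)))
    rwa [count_intercalate, if_neg (hB b hb c hc).ne, add_zero,
      count_flatten_of_pairwise_disjoint hd hb hc] at this
  · intro h c hc
    rw [count_intercalate]
    have hm : m ∉ B.flatten := by
      intro hm
      obtain ⟨b, hb, hmb⟩ := List.mem_flatten.1 hm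
      exact lt_irrefl _ (hB b hb m hmb)
    rcases mem_intercalate_iff.1 hc with hc | ⟨rfl, -⟩
    · obtain ⟨b, hb, hcb⟩ := List.mem_flatten.1 hc
      rw [if_neg (hB b hb c hcb).ne, add_zero, count_flatten_of_pairwise_disjoint hd hb hcb]
      exact h b hb c hcb
    · rw [if_pos rfl, List.count_eq_zero.2 hm, hr]; simp

/-- r+1 blocks are separated by exactly r copies of m, and every other letter keeps its
multiplicity. Thus deleting m loses no information about admissibility. -/
theorem isStirlingList_replace_iff {r m : ℕ} {L₁ B L₂ : List (List ℕ)}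
    (hB : ∀ b ∈ L₁ ++ B ++ L₂, ∀ c ∈ b, c < m) (hr : B.length = r + 1) :
    IsStirlingList r (L₁ ++ [[m].intercalate B] ++ L₂) ↔ IsStirlingList r (L₁ ++ B ++ L₂) := by
  simp only [List.mem_append, or_imp, forall_and] at hB
  have h1 : ∀ u ∈ L₁, List.Disjoint u ([m].intercalate B) ↔ ∀ b ∈ B, List.Disjoint u b := by
    refine fun u hu => ⟨fun h b hb c hcu hcb => h hcu
      (mem_intercalate_iff.2 (Or.inl (List.mem_flatten.2 ⟨b, hb, hcb⟩))), fun h c hcu hc => ?_⟩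
    rcases mem_intercalate_iff.1 hc with hc | ⟨rfl, -⟩
    · obtain ⟨b, hb, hcb⟩ := List.mem_flatten.1 hc
      exact h b hb hcu hcb
    · exact lt_irrefl _ (hB.1.1 u hu c hcu)
  have h2 : ∀ u ∈ L₂, List.Disjoint ([m].intercalate B) u ↔ ∀ b ∈ B, List.Disjoint b u := by
    refine fun u hu => ⟨fun h b hb c hcb hcu => h
      (mem_intercalate_iff.2 (Or.inl (List.mem_flatten.2 ⟨b, hb, hcb⟩))) hcu, fun h c hc hcu => ?_⟩
    rcases mem_intercalate_iff.1 hc with hc | ⟨rfl, -⟩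
    · obtain ⟨b, hb, hcb⟩ := List.mem_flatten.1 hc
      exact h b hb hcb hcu
    · exact lt_irrefl _ (hB.2 u hu c hcu)
  have e1 : (∀ u ∈ L₁, List.Disjoint u ([m].intercalate B)) ↔
      ∀ u ∈ L₁, ∀ b ∈ B, List.Disjoint u b := forall₂_congr h1
  have e2 : (∀ u ∈ L₂, List.Disjoint ([m].intercalate B) u) ↔
      ∀ b ∈ B, ∀ u ∈ L₂, List.Disjoint b u :=
    (forall₂_congr h2).trans ⟨fun h b hb u hu => h u hu b hb, fun h u hu b hb => h b hb u hu⟩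
  simp only [isStirlingList_append, isStirlingList_singleton_intercalate_iff hB.1.2 hr,
    List.mem_append, or_imp, forall_and, List.mem_singleton, forall_eq, e1, e2]

end Words

/-! ### Stack-sorting around the largest letter -/

section Sorting

theorem le_maxLetter {w : List ℕ} {c : ℕ} (hc : c ∈ w) : c ≤ maxLetter w := by
  induction w with
  | nil => simp at hc
  | cons a w ih =>
    have e : maxLetter (a :: w) = max a (maxLetter w) := rfl
    rw [e]
    rcases List.mem_cons.1 hc with rfl | hc
    · exact le_max_left _ _
    · exact (ih hc).trans (le_max_right _ _)

theorem maxLetter_eq {w : List ℕ} {m : ℕ} (hm : m ∈ w) (h : ∀ c ∈ w, c ≤ m) : maxLetter w = m :=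
  le_antisymm (h _ (maxLetter_mem (List.ne_nil_of_mem hm))) (le_maxLetter hm)

/-- The concatenation of the stack-sorted words of a list. -/
def sortBlocks (L : List (List ℕ)) : List ℕ := (L.map stackSort).flatten

theorem sortBlocks_append (L₁ L₂ : List (List ℕ)) :
    sortBlocks (L₁ ++ L₂) = sortBlocks L₁ ++ sortBlocks L₂ := by
  simp [sortBlocks]

theorem stackSort_intercalate {m : ℕ} {B : List (List ℕ)} (hB : ∀ b ∈ B, ∀ c ∈ b, c < m)
    (h2 : 2 ≤ B.length) : stackSort ([m].intercalate B) = sortBlocks B ++ [m] := by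
  -- With fewer than two blocks the separator m would not occur at all.
  have hm : m ∈ [m].intercalate B := mem_intercalate_iff.2 (Or.inr ⟨rfl, h2⟩)
  have hmax : maxLetter ([m].intercalate B) = m := by
    refine maxLetter_eq hm fun c hc => ?_
    rcases mem_intercalate_iff.1 hc with hc | ⟨rfl, -⟩
    · obtain ⟨b, hb, hcb⟩ := List.mem_flatten.1 hc
      exact (hB b hb c hcb).le
    · exact le_rfl
  have hne : B ≠ [] := by rintro rfl; simp at h2
  rw [stackSort_of_ne_nil (List.ne_nil_of_mem hm), hmax,
    List.splitOn_intercalate m (fun b hb hmb => lt_irrefl _ (hB b hb m hmb)) hne, sortBlocks]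

theorem mem_stackSort_iff {c : ℕ} (w : List ℕ) : c ∈ stackSort w ↔ c ∈ w := by
  by_cases h : w = []
  · rw [h, stackSort_nil]
  · have hm := maxLetter_mem h
    rw [stackSort_of_ne_nil h, List.mem_append, List.mem_singleton]
    have hsub : c ∈ ((w.splitOn (maxLetter w)).map stackSort).flatten ↔
        c ∈ (w.splitOn (maxLetter w)).flatten := by
      simp only [List.mem_flatten, List.mem_map, exists_exists_and_eq_and]
      refine exists_congr fun v => and_congr_right fun hv => ?_
      have := length_lt_of_mem_splitOn hm v hv
      exact mem_stackSort_iff v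
    have key := mem_intercalate_iff (m := maxLetter w) (c := c) (B := w.splitOn (maxLetter w))
    rw [List.intercalate_splitOn] at key
    rw [hsub]
    constructor
    · rintro (hc | rfl)
      · exact key.2 (Or.inl hc)
      · exact hm
    · exact fun hc => (key.1 hc).imp_right And.left
termination_by w.length

theorem mem_sortBlocks_iff {c : ℕ} {L : List (List ℕ)} : c ∈ sortBlocks L ↔ c ∈ L.flatten := by
  simp [sortBlocks, mem_stackSort_iff]

theorem stackSort_append_cons {m : ℕ} {u v : List ℕ} (hu : ∀ c ∈ u, c < m) (hv : ∀ c ∈ v, c < m) :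
    stackSort (u ++ m :: v) = stackSort u ++ stackSort v ++ [m] := by
  have h := stackSort_intercalate (m := m) (B := [u, v]) (by simpa using ⟨hu, hv⟩) (by simp)
  simpa [sortBlocks] using h

/-- After the first pass m occurs once, directly behind the sorted images of `L₁ ++ B`; the second
pass cuts there. -/
theorem stackSort_sortBlocks_replace {m : ℕ} {L₁ B L₂ : List (List ℕ)}
    (hB : ∀ b ∈ L₁ ++ B ++ L₂, ∀ c ∈ b, c < m) (h2 : 2 ≤ B.length) :
    stackSort (sortBlocks (L₁ ++ [[m].intercalate B] ++ L₂)) =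
      stackSort (sortBlocks (L₁ ++ B)) ++ stackSort (sortBlocks L₂) ++ [m] := by
  have hlt : ∀ L, (∀ b ∈ L, b ∈ L₁ ++ B ++ L₂) → ∀ c ∈ sortBlocks L, c < m := by
    intro L hL c hc
    obtain ⟨b, hb, hcb⟩ := List.mem_flatten.1 (mem_sortBlocks_iff.1 hc)
    exact hB b (hL b hb) c hcb
  have hw : sortBlocks [[m].intercalate B] = sortBlocks B ++ [m] := by
    rw [← stackSort_intercalate (fun b hb => hB b (by simp [hb])) h2]
    simp [sortBlocks]
  rw [← stackSort_append_cons (hlt _ fun b hb => List.mem_append_left _ hb)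
    (hlt _ fun b hb => List.mem_append_right _ hb),
    sortBlocks_append (L₁ ++ _), sortBlocks_append L₁, sortBlocks_append L₁, hw]
  simp

end Sorting

/-! ### The quadratic recurrence for the counts -/

section Recurrence

/-- Lists of `k` words on the letters `a + 1, …, a + n` that form a two-stack-sortable tuple
`r`-permutation. -/
def sortableTuples (r a n k : ℕ) : Set (List (List ℕ)) :=
  {L | L.length = k ∧ IsStirlingList r L ∧ stackSort (sortBlocks L) = List.range' (a + 1) n}

theorem mem_flatten_of_mem_sortableTuples {r a n k : ℕ} {L : List (List ℕ)}
    (hL : L ∈ sortableTuples r a n k) {c : ℕ} : c ∈ L.flatten ↔ a < c ∧ c ≤ a + n := by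
  rw [← mem_sortBlocks_iff, ← mem_stackSort_iff, hL.2.2, List.mem_range'_1]
  omega

/-- The interval a+1,…,a+n is cut at a+j into the outputs of the two groups. Disjointness between
the groups then comes for free, as their letters fill disjoint intervals. -/
theorem mem_sortableTuples_replace_iff {r a n k : ℕ} (hr : 1 ≤ r) {L₁ B L₂ : List (List ℕ)}
    (hB : ∀ b ∈ L₁ ++ B ++ L₂, ∀ c ∈ b, c < a + n + 1) (hlen : B.length = r + 1) :
    L₁ ++ [[a + n + 1].intercalate B] ++ L₂ ∈ sortableTuples r a (n + 1) k ↔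
      ∃ j ≤ n, L₁ ++ B ∈ sortableTuples r a j (L₁.length + 1 + r) ∧
        L₂ ∈ sortableTuples r (a + j) (n - j) (k - 1 - L₁.length) ∧ L₁.length < k := by
  have hsplit : stackSort (sortBlocks (L₁ ++ B)) ++ stackSort (sortBlocks L₂) ++ [a + n + 1] =
      List.range' (a + 1) (n + 1) ↔ ∃ j ≤ n, stackSort (sortBlocks (L₁ ++ B)) =
        List.range' (a + 1) j ∧ stackSort (sortBlocks L₂) = List.range' (a + j + 1) (n - j) := by
    rw [List.range'_1_concat, add_right_comm a 1 n, List.append_left_inj, eq_comm,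
      List.range'_eq_append_iff]
    simp only [mul_one, add_right_comm a 1]
  simp only [sortableTuples, Set.mem_ofPred_eq, isStirlingList_replace_iff hB hlen,
    stackSort_sortBlocks_replace hB (by omega), hsplit]
  constructor
  · rintro ⟨h1, h2, j, hj, h3, h4⟩
    rw [isStirlingList_append] at h2
    simp only [List.length_append, List.length_singleton] at h1
    refine ⟨j, hj, ⟨?_, h2.1, h3⟩, ⟨?_, h2.2.1, h4⟩, ?_⟩
    · rw [List.length_append, hlen]; omega
    · omega
    · omega
  · rintro ⟨j, hj, h1, h2, h3⟩
    refine ⟨?_, ?_, j, hj, h1.2.2, h2.2.2⟩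
    · simp only [List.length_append, List.length_singleton]; omega
    · refine isStirlingList_append.2 ⟨h1.2.1, h2.2.1, fun u hu v hv c hcu hcv => ?_⟩
      have e1 := (mem_flatten_of_mem_sortableTuples h1).1 (List.mem_flatten.2 ⟨u, hu, hcu⟩)
      have e2 := (mem_flatten_of_mem_sortableTuples h2).1 (List.mem_flatten.2 ⟨v, hv, hcv⟩)
      omega

/-- Joining the words of `p.1` from position `i` on by the letter `m`, and appending `p.2`. -/
def joinAt (m i : ℕ) (p : List (List ℕ) × List (List ℕ)) : List (List ℕ) :=
  p.1.take i ++ [[m].intercalate (p.1.drop i)] ++ p.2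

theorem lt_of_mem_sortableTuples {r a n j k k' : ℕ} (hj : j ≤ n) {L₁ L₂ : List (List ℕ)}
    (h1 : L₁ ∈ sortableTuples r a j k) (h2 : L₂ ∈ sortableTuples r (a + j) (n - j) k') :
    ∀ b ∈ L₁ ++ L₂, ∀ c ∈ b, c < a + n + 1 := by
  intro b hb c hcb
  rcases List.mem_append.1 hb with hb | hb
  · have := (mem_flatten_of_mem_sortableTuples h1).1 (List.mem_flatten.2 ⟨b, hb, hcb⟩)
    omega
  · have := (mem_flatten_of_mem_sortableTuples h2).1 (List.mem_flatten.2 ⟨b, hb, hcb⟩)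
    omega

theorem mem_sortableTuples_succ_iff {r a n k : ℕ} (hr : 1 ≤ r) {L : List (List ℕ)} :
    L ∈ sortableTuples r a (n + 1) k ↔ ∃ i < k, ∃ j ≤ n,
      ∃ p ∈ sortableTuples r a j (i + 1 + r) ×ˢ sortableTuples r (a + j) (n - j) (k - 1 - i),
        joinAt (a + n + 1) i p = L := by
  constructor
  · intro hL
    have hmem := fun c => mem_flatten_of_mem_sortableTuples hL (c := c)
    obtain ⟨w, hwL, hmw⟩ := List.mem_flatten.1 ((hmem (a + n + 1)).2 (by omega))
    obtain ⟨L₁, L₂, rfl⟩ := List.append_of_mem hwL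
    have hgood := hL.2.1
    have hd := hgood.1
    rw [List.pairwise_append, List.pairwise_cons] at hd
    obtain ⟨B, rfl, -, hmB⟩ := exists_eq_intercalate (a + n + 1) w
    have hcount := (hgood.2 _ hwL).2 _ hmw
    have hmB' : a + n + 1 ∉ B.flatten := fun h => by
      obtain ⟨b, hb, hmb⟩ := List.mem_flatten.1 h
      exact hmB b hb hmb
    -- The top letter occurs r times in its component, and only as a separator: this forces r+1
    -- blocks.
    rw [count_intercalate, if_pos rfl, List.count_eq_zero.2 hmB'] at hcount
    have hB : ∀ b ∈ L₁ ++ B ++ L₂, ∀ c ∈ b, c < a + n + 1 := by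
      intro b hb c hcb
      have hne : c ≠ a + n + 1 := by
        rintro rfl
        simp only [List.mem_append] at hb
        rcases hb with (hb | hb) | hb
        · exact hd.2.2 b hb _ (by simp) hcb hmw
        · exact hmB b hb hcb
        · exact hd.2.1.1 b hb hmw hcb
      have hc : c ∈ (L₁ ++ [a + n + 1].intercalate B :: L₂).flatten := by
        simp only [List.flatten_append, List.flatten_cons, List.mem_append, mem_intercalate_iff,
          List.mem_flatten]
        simp only [List.mem_append] at hb
        rcases hb with (hb | hb) | hb
        · exact Or.inl ⟨b, hb, hcb⟩
        · exact Or.inr (Or.inl (Or.inl ⟨b, hb, hcb⟩))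
        · exact Or.inr (Or.inr ⟨b, hb, hcb⟩)
      have := (hmem c).1 hc
      omega
    rw [← List.singleton_append, ← List.append_assoc,
      mem_sortableTuples_replace_iff hr hB (by omega)] at hL
    obtain ⟨j, hj, h1, h2, h3⟩ := hL
    exact ⟨L₁.length, h3, j, hj, ⟨L₁ ++ B, L₂⟩, ⟨h1, h2⟩, by simp [joinAt]⟩
  · rintro ⟨i, hi, j, hj, ⟨L₁, L₂⟩, ⟨h1, h2⟩, rfl⟩
    simp only at h1 h2
    have hl : (L₁.take i).length = i := by rw [List.length_take, h1.1]; omega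
    have hB := lt_of_mem_sortableTuples hj h1 h2
    rw [← List.take_append_drop i L₁] at hB
    refine (mem_sortableTuples_replace_iff hr hB ?_).2 ⟨j, hj, ?_, ?_, ?_⟩
    · rw [List.length_drop, h1.1]; omega
    · rwa [List.take_append_drop, hl]
    · rwa [hl]
    · rwa [hl]

theorem append_singleton_append_inj {α : Type*} {p : α → Prop} {l₁ l₂ l₁' l₂' : List α} {x x' : α}
    (h : l₁ ++ [x] ++ l₂ = l₁' ++ [x'] ++ l₂') (hx : p x) (hx' : p x') (h1 : ∀ z ∈ l₁, ¬ p z)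
    (h1' : ∀ z ∈ l₁', ¬ p z) : l₁ = l₁' ∧ x = x' ∧ l₂ = l₂' := by
  simp only [List.append_assoc, List.singleton_append] at h
  rcases List.append_eq_append_iff.1 h with ⟨s, h2, h3⟩ | ⟨s, h2, h3⟩ <;> cases s with
  | nil => simp_all
  | cons z s =>
    simp only [List.cons_append, List.cons.injEq] at h3
    obtain ⟨rfl, -⟩ := h3
    simp_all

/-- The unique component containing the top letter is recognizable, and splitting it at that letter
recovers the blocks. Then i is read off from the length of the first list and j from the length of
its sorted output. -/
theorem joinAt_injective {r a n i i' j j' k k' : ℕ} (hr : 1 ≤ r) (hj : j ≤ n) (hj' : j' ≤ n)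
    {p p' : List (List ℕ) × List (List ℕ)}
    (hp : p ∈ sortableTuples r a j (i + 1 + r) ×ˢ sortableTuples r (a + j) (n - j) k)
    (hp' : p' ∈ sortableTuples r a j' (i' + 1 + r) ×ˢ sortableTuples r (a + j') (n - j') k')
    (h : joinAt (a + n + 1) i p = joinAt (a + n + 1) i' p') : i = i' ∧ j = j' ∧ p = p' := by
  obtain ⟨L₁, L₂⟩ := p
  obtain ⟨L₁', L₂'⟩ := p'
  obtain ⟨h1, h2⟩ := hp
  obtain ⟨h1', h2'⟩ := hp'
  simp only at h1 h2 h1' h2'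
  have hB := lt_of_mem_sortableTuples hj h1 h2
  have hB' := lt_of_mem_sortableTuples hj' h1' h2'
  have hl : (L₁.drop i).length = r + 1 := by rw [List.length_drop, h1.1]; omega
  have hl' : (L₁'.drop i').length = r + 1 := by rw [List.length_drop, h1'.1]; omega
  obtain ⟨e1, e2, rfl⟩ := append_singleton_append_inj (p := fun w => a + n + 1 ∈ w) h
    (mem_intercalate_iff.2 (Or.inr ⟨rfl, show 2 ≤ (L₁.drop i).length by omega⟩))
    (mem_intercalate_iff.2 (Or.inr ⟨rfl, show 2 ≤ (L₁'.drop i').length by omega⟩))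
    (fun z hz hm => lt_irrefl _ (hB z (List.mem_append_left _ (List.mem_of_mem_take hz)) _ hm))
    (fun z hz hm => lt_irrefl _ (hB' z (List.mem_append_left _ (List.mem_of_mem_take hz)) _ hm))
  have e3 := congrArg (List.splitOn (a + n + 1)) e2
  rw [List.splitOn_intercalate, List.splitOn_intercalate] at e3
  · have e4 : L₁ = L₁' := by
      rw [← List.take_append_drop i L₁, e1, e3, List.take_append_drop]
    subst e4
    refine ⟨?_, ?_, rfl⟩
    · have := h1.1.symm.trans h1'.1
      omega
    · simpa using congrArg List.length (h1.2.2.symm.trans h1'.2.2)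
  · exact fun z hz hm => lt_irrefl _ (hB' z (List.mem_append_left _ (List.mem_of_mem_drop hz)) _ hm)
  · rintro h0; simp [h0] at hl'
  · exact fun z hz hm => lt_irrefl _ (hB z (List.mem_append_left _ (List.mem_of_mem_drop hz)) _ hm)
  · rintro h0; simp [h0] at hl

theorem sortableTuples_zero (r a k : ℕ) : sortableTuples r a 0 k = {List.replicate k []} := by
  ext L
  rw [Set.mem_singleton_iff, List.eq_replicate_iff]
  constructor
  · intro hL
    refine ⟨hL.1, fun b hb => List.eq_nil_iff_forall_not_mem.2 fun c hc => ?_⟩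
    have := (mem_flatten_of_mem_sortableTuples hL).1 (List.mem_flatten.2 ⟨b, hb, hc⟩)
    omega
  · rintro ⟨h1, h2⟩
    refine ⟨h1, ⟨?_, ?_⟩, ?_⟩
    · obtain rfl := List.eq_replicate_iff.2 ⟨h1, h2⟩
      simp [List.pairwise_replicate]
    · intro w hw
      rw [h2 w hw]
      simp [IsStirling]
    · have : sortBlocks L = [] := by
        rw [List.eq_nil_iff_forall_not_mem]
        intro c hc
        obtain ⟨b, hb, hcb⟩ := List.mem_flatten.1 (mem_sortBlocks_iff.1 hc)
        simp [h2 b hb] at hcb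
      rw [this, stackSort_nil, List.range'_zero]

/-- The sets are handled as finsets so that finiteness is carried along with the cardinality. The
count `N` does not involve the shift a, which is needed because the second group uses the shift a+j.
-/
theorem exists_finset_sortableTuples_succ {r n : ℕ} (hr : 1 ≤ r) {N : ℕ → ℕ → ℕ}
    (hN : ∀ a k, ∀ m ≤ n, ∃ s : Finset (List (List ℕ)), (s : Set _) = sortableTuples r a m k ∧
      s.card = N m k) (a k : ℕ) :
    ∃ s : Finset (List (List ℕ)), (s : Set _) = sortableTuples r a (n + 1) k ∧
      s.card = ∑ i ∈ Finset.range k, ∑ j ∈ Finset.range (n + 1),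
        N j (i + 1 + r) * N (n - j) (k - 1 - i) := by
  have hN' : ∀ a k m, ∃ s : Finset (List (List ℕ)), m ≤ n →
      (s : Set _) = sortableTuples r a m k ∧ s.card = N m k := by
    intro a k m
    by_cases hm : m ≤ n
    · obtain ⟨s, hs⟩ := hN a k m hm
      exact ⟨s, fun _ => hs⟩
    · exact ⟨∅, fun h => absurd h hm⟩
  choose s hs using hN'
  let I : Finset (Σ _ : ℕ × ℕ, List (List ℕ) × List (List ℕ)) :=
    (Finset.range k ×ˢ Finset.range (n + 1)).sigma fun q =>
      s a (q.1 + 1 + r) q.2 ×ˢ s (a + q.2) (k - 1 - q.1) (n - q.2)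
  have hI : ∀ x ∈ I, x.1.1 < k ∧ x.1.2 ≤ n ∧ x.2 ∈ sortableTuples r a x.1.2 (x.1.1 + 1 + r) ×ˢ
      sortableTuples r (a + x.1.2) (n - x.1.2) (k - 1 - x.1.1) := by
    intro x hx
    simp only [I, Finset.mem_sigma, Finset.mem_product, Finset.mem_range] at hx
    obtain ⟨⟨h1, h2⟩, h3, h4⟩ := hx
    refine ⟨h1, by omega, ?_, ?_⟩
    · rw [← (hs a (x.1.1 + 1 + r) x.1.2 (by omega)).1]; exact h3
    · rw [← (hs (a + x.1.2) (k - 1 - x.1.1) (n - x.1.2) (by omega)).1]; exact h4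
  refine ⟨I.image fun x => joinAt (a + n + 1) x.1.1 x.2, ?_, ?_⟩
  · ext L
    rw [mem_sortableTuples_succ_iff hr]
    simp only [Finset.coe_image, Set.mem_image, Finset.mem_coe]
    constructor
    · rintro ⟨x, hx, rfl⟩
      obtain ⟨h1, h2, h3⟩ := hI x hx
      exact ⟨_, h1, _, h2, _, h3, rfl⟩
    · rintro ⟨i, hi, j, hj, p, ⟨h1, h2⟩, rfl⟩
      refine ⟨⟨(i, j), p⟩, ?_, rfl⟩
      simp only [I, Finset.mem_sigma, Finset.mem_product, Finset.mem_range]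
      refine ⟨⟨hi, by omega⟩, ?_, ?_⟩
      · rw [← Finset.mem_coe, (hs _ _ _ hj).1]; exact h1
      · rw [← Finset.mem_coe, (hs _ _ _ (by omega)).1]; exact h2
  · rw [Finset.card_image_of_injOn, Finset.card_sigma, Finset.sum_product]
    · refine Finset.sum_congr rfl fun i _ => Finset.sum_congr rfl fun j hj => ?_
      have := Finset.mem_range.1 hj
      rw [Finset.card_product, (hs _ _ _ (by omega)).2, (hs _ _ _ (by omega)).2]
    · rintro ⟨⟨i, j⟩, p⟩ hx ⟨⟨i', j'⟩, p'⟩ hx' h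
      obtain ⟨-, h2, h3⟩ := hI _ hx
      obtain ⟨-, h2', h3'⟩ := hI _ hx'
      obtain ⟨rfl, rfl, rfl⟩ := joinAt_injective hr h2 h2' h3 h3' h
      rfl

/-- Independence of the shift a needs no relabelling of letters: every shift satisfies the same
recurrence. -/
theorem exists_finset_sortableTuples {r : ℕ} (hr : 1 ≤ r) (n a k : ℕ) :
    ∃ s : Finset (List (List ℕ)), (s : Set _) = sortableTuples r a n k ∧
      s.card = (sortableTuples r 0 n k).ncard := by
  induction n using Nat.strong_induction_on generalizing a k with
  | _ n ih =>
    cases n with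
    | zero => exact ⟨{List.replicate k []}, by simp [sortableTuples_zero]⟩
    | succ n =>
      have h := exists_finset_sortableTuples_succ (n := n) hr
        (N := fun n k => (sortableTuples r 0 n k).ncard) fun a k m hm => ih m (by omega) a k
      obtain ⟨s, hs, hc⟩ := h a k
      obtain ⟨s₀, hs₀, hc₀⟩ := h 0 k
      exact ⟨s, hs, by rw [← hs₀, Set.ncard_coe_finset, hc, hc₀]⟩

/-- For disjoint components the conditions on the concatenation become conditions on each word; that
exactly 1,…,n occur follows from the sorted output, since sorting preserves the set of letters. -/
theorem pCoeff_eq_ncard_sortableTuples (r n k : ℕ) :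
    pCoeff r k n = (sortableTuples r 0 n k).ncard := by
  have key : ∀ α : Fin k → List ℕ, IsTwoStackSortable r n k α ↔
      List.ofFn α ∈ sortableTuples r 0 n k := by
    intro α
    have hsort : (List.ofFn fun i => stackSort (α i)).flatten = sortBlocks (List.ofFn α) := by
      rw [sortBlocks, List.map_ofFn]; rfl
    have hdisj : (∀ (i j : Fin k) (a : ℕ), a ∈ α i → a ∈ α j → i = j) ↔
        (List.ofFn α).Pairwise List.Disjoint := by
      rw [List.pairwise_ofFn]
      constructor
      · exact fun h i j hij c hi hj => hij.ne (h i j c hi hj)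
      · intro h i j c hi hj
        rcases lt_trichotomy i j with hij | hij | hij
        · exact absurd hj (h hij hi)
        · exact hij
        · exact absurd hi (h hij hj)
    rw [IsTwoStackSortable, IsTupleRPerm, IsRPerm, hdisj, hsort]
    constructor
    · rintro ⟨⟨⟨hc, hst⟩, hd⟩, hs⟩
      refine ⟨List.length_ofFn, ⟨hd, fun w hw =>
        ⟨(isStirling_flatten_iff hd).1 hst w hw, fun c hcw => ?_⟩⟩, by simpa using hs⟩
      have hmem : c ∈ (List.ofFn α).flatten := List.mem_flatten.2 ⟨w, hw, hcw⟩
      have hpos := List.count_pos_iff.2 hmem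
      rw [hc c] at hpos
      rw [← count_flatten_of_pairwise_disjoint hd hw hcw, hc c]
      split_ifs at hpos ⊢ <;> omega
    · intro hL
      have hmem := fun c => mem_flatten_of_mem_sortableTuples hL (c := c)
      obtain ⟨-, ⟨hd, hw⟩, hs⟩ := hL
      refine ⟨⟨⟨fun c => ?_, (isStirling_flatten_iff hd).2 fun w h => (hw w h).1⟩, hd⟩,
        by simpa using hs⟩
      split_ifs with hc
      · obtain ⟨w, hwL, hcw⟩ := List.mem_flatten.1 ((hmem c).2 (by omega))
        rw [count_flatten_of_pairwise_disjoint hd hwL hcw]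
        exact (hw w hwL).2 c hcw
      · exact List.count_eq_zero.2 fun h => hc (by have := (hmem c).1 h; omega)
  have himage : List.ofFn '' {α : Fin k → List ℕ | IsTwoStackSortable r n k α} =
      sortableTuples r 0 n k := by
    ext L
    constructor
    · rintro ⟨α, hα, rfl⟩
      exact (key α).1 hα
    · intro hL
      obtain rfl := hL.1
      refine ⟨L.get, (key _).2 ?_, List.ofFn_get L⟩
      rwa [List.ofFn_get]
  rw [pCoeff, ← himage, Set.ncard_image_of_injective _ List.ofFn_injective]

theorem pCoeff_zero (r k : ℕ) : pCoeff r k 0 = 1 := by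
  rw [pCoeff_eq_ncard_sortableTuples, sortableTuples_zero, Set.ncard_singleton]

theorem pCoeff_succ {r : ℕ} (hr : 1 ≤ r) (k n : ℕ) :
    pCoeff r k (n + 1) = ∑ i ∈ Finset.range k, ∑ j ∈ Finset.range (n + 1),
      pCoeff r (i + 1 + r) j * pCoeff r (k - 1 - i) (n - j) := by
  obtain ⟨s, hs, hc⟩ := exists_finset_sortableTuples_succ (n := n) hr
    (fun a k m _ => exists_finset_sortableTuples hr m a k) 0 k
  simp only [pCoeff_eq_ncard_sortableTuples]
  rw [← hs, Set.ncard_coe_finset, hc]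

theorem pSeries_eq {r : ℕ} (hr : 1 ≤ r) (k : ℕ) :
    pSeries r k = 1 + PowerSeries.X * ∑ i ∈ Finset.range k,
      pSeries r (i + 1 + r) * pSeries r (k - 1 - i) := by
  ext n
  cases n with
  | zero => simp [pSeries, pCoeff_zero]
  | succ n =>
    rw [map_add, PowerSeries.coeff_succ_X_mul, PowerSeries.coeff_one, if_neg (by omega), zero_add,
      map_sum, pSeries, PowerSeries.coeff_mk, pCoeff_succ hr, Nat.cast_sum]
    refine Finset.sum_congr rfl fun i _ => ?_
    rw [PowerSeries.coeff_mul, Finset.Nat.sum_antidiagonal_eq_sum_range_succ_mk, Nat.cast_sum]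
    simp [pSeries]

end Recurrence

/-! ### Uniqueness and conclusion -/

/-- A family of power series satisfying the quadratic recurrence of the series `p_k` is unique. -/
theorem eq_of_quadratic_recurrence {R : Type*} [CommRing R] {r : ℕ} {F G : ℕ → PowerSeries R}
    (hF : ∀ k, F k = 1 + PowerSeries.X * ∑ i ∈ Finset.range k, F (i + 1 + r) * F (k - 1 - i))
    (hG : ∀ k, G k = 1 + PowerSeries.X * ∑ i ∈ Finset.range k, G (i + 1 + r) * G (k - 1 - i))
    (k : ℕ) : F k = G k := by
  have h : ∀ n k, (PowerSeries.X : PowerSeries R) ^ n ∣ F k - G k := by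
    intro n
    induction n with
    | zero => simp
    | succ n ih =>
      intro k
      rw [hF k, hG k, add_sub_add_left_eq_sub, ← mul_sub, ← Finset.sum_sub_distrib, pow_succ']
      refine mul_dvd_mul_left _ (Finset.dvd_sum fun i _ => ?_)
      have e : F (i + 1 + r) * F (k - 1 - i) - G (i + 1 + r) * G (k - 1 - i) =
          (F (i + 1 + r) - G (i + 1 + r)) * F (k - 1 - i) +
            G (i + 1 + r) * (F (k - 1 - i) - G (k - 1 - i)) := by ring
      rw [e]
      exact dvd_add ((ih _).mul_right _) ((ih _).mul_left _)
  rw [← sub_eq_zero]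
  ext n
  simpa using PowerSeries.X_pow_dvd_iff.1 (h (n + 1) k) n (Nat.lt_succ_self n)

end StackSort

theorem mainTheorem9 (r : ℕ) (hr : 1 ≤ r) :
    (∃! y : PowerSeries ℚ, StackSort.IsY r y) ∧
      ∀ y : PowerSeries ℚ, StackSort.IsY r y →
        ∀ k : ℕ, ∃ Q : Polynomial ℚ,
          Q.natDegree ≤ 2 * k ∧ StackSort.pSeries r k = Polynomial.aeval y Q := by
  refine ⟨StackSort.existsUnique_isY r, fun y hy k => ?_⟩
  obtain ⟨Q, hdeg, hQ⟩ := StackSort.exists_polynomial_recurrence r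
  refine ⟨Q k, hdeg k, StackSort.eq_of_quadratic_recurrence (StackSort.pSeries_eq hr)
    (G := fun k => Polynomial.aeval y (Q k)) (fun k => ?_) k⟩
  have hx := StackSort.isY_iff.1 hy
  -- If this power vanished, then y = X·0 = 0 and the power would be 1.
  have hne : (1 + y) ^ (2 * r + 1) ≠ 0 := by
    intro h
    rw [h, mul_zero] at hx
    simp [← hx] at h
  have h := congrArg (Polynomial.aeval y) (hQ k)
  simp only [map_mul, map_add, map_pow, map_one, Polynomial.aeval_X, map_sum] at h
  -- After multiplication by (1+y)^(2r+1), the relation X(1+y)^(2r+1) = y turns the recurrence in x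
  -- into the one satisfied by `Q`.
  refine mul_left_cancel₀ hne ?_
  rw [h, mul_add, mul_one, ← mul_assoc, mul_comm _ PowerSeries.X, hx]
  congr 2
  refine Finset.sum_congr rfl fun i _ => ?_
  rw [show r + (i + 1) = i + 1 + r by omega, show k - (i + 1) = k - 1 - i by omega]
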